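/- For integers $l \ge 0$, $d \ge 1$ and $s \in \mathbb{Z}_{\ge 0}^d$ write $|s| = s_1 + \cdots + s_d$, $s! = s_1! \cdots s_d!$, and $u^s = u_1^{s_1} \cdots u_d^{s_d}$ for $u \in \mathbb{R}^d$. Let $U : \mathbb{R}^d \to \mathbb{R}^D$, where $D = \#\{s \in \mathbb{Z}_{\ge 0}^d : |s| \le l\}$, be the vector-valued function $$U(u) = \left[ \frac{u^s}{s!} : s \in \mathbb{Z}_{\ge 0}^d,\ |s| \le l \right]^{\mathrm{T}},$$ let $\mathcal{B} = \int_{[-1,1]^d} U(u) U(u)^{\mathrm{T}} \, du$ (entrywise Lebesgue integral), and define $$\Lambda(d,l) = \left(\frac{\pi d}{8 e^2}\right)^{d \left(\frac{l+d}{d}\right)^{d}} \left(\left(\frac{l+d}{d}\right)^{d} - 1 \right)^{\left(\frac{l+d}{d}\right)^{d} - 1} \frac{1}{(l+d)^{3l \left(\frac{e(l+d)}{d}\right)^{d}}} .$$ **Lemma (Auxiliary Löwner Lower Bound).** If $l \ge d \ge 19$, then $\Lambda(d,l) > 0$ and the $D \times D$ symmetric matrix $\mathcal{B}$ satisfies $$\mathcal{B}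 \succeq \Lambda(d,l)\, I_D,$$ that is, $\mathcal{B} - \Lambda(d,l) I_D$ is positive semidefinite. -/

import Mathlib

/-- The index set `{s ∈ ℤ₊^d : |s| ≤ l}` of multi-indices in `d` variables of total degree
at most `l`. -/
abbrev MultiIndex (d l : ℕ) : Type :=
  {s : Fin d → Fin (l + 1) // ∑ j, (s j : ℕ) ≤ l}

/-- The vector `U(u)` of scaled monomials `u^s / s!`, `|s| ≤ l`, with `u^s = ∏ⱼ uⱼ^{sⱼ}` and
`s! = ∏ⱼ sⱼ!`. -/
noncomputable def scaledMonomials (d l : ℕ) (u : Fin d → ℝ) : MultiIndex d l → ℝ :=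
  fun s => (∏ j, u j ^ (s.1 j : ℕ)) / (∏ j, (Nat.factorial (s.1 j : ℕ) : ℝ))

/-- The moment matrix `∫_{[-1,1]^d} U(u) U(u)ᵀ du`, integrated entrywise with respect to
Lebesgue measure; `Set.Icc (fun _ => -1) (fun _ => 1)` is the cube `[-1,1]^d`. -/
noncomputable def momentMatrix (d l : ℕ) : Matrix (MultiIndex d l) (MultiIndex d l) ℝ :=
  fun r s => ∫ u in Set.Icc (fun _ : Fin d => (-1 : ℝ)) (fun _ => (1 : ℝ)),
    Matrix.vecMulVec (scaledMonomials d l u) (scaledMonomials d l u) r s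

/-- Every entry of `U(u) U(u)ᵀ` is integrable over the cube. -/
theorem integrableOn_momentMatrix_entry (d l : ℕ) (r s : MultiIndex d l) :
    MeasureTheory.IntegrableOn (fun u : Fin d → ℝ =>
      Matrix.vecMulVec (scaledMonomials d l u) (scaledMonomials d l u) r s)
      (Set.Icc (fun _ : Fin d => (-1 : ℝ)) (fun _ => (1 : ℝ))) := by
  apply ContinuousOn.integrableOn_compact isCompact_Icc
  apply Continuous.continuousOn
  simp only [Matrix.vecMulVec_apply, scaledMonomials]
  fun_prop

/-- With `q = ((l + d)/d)^d`,
`Λ(d,l) = (π d / (8 e²))^{d q} (q - 1)^{q - 1} / (l + d)^{3 l (e (l + d)/d)^d}`,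
the non-integer powers being real powers. -/
noncomputable def loewnerConst (d l : ℕ) : ℝ :=
  (Real.pi * d / (8 * Real.exp 1 ^ 2)) ^ ((d : ℝ) * (((l : ℝ) + d) / d) ^ d)
    * ((((l : ℝ) + d) / d) ^ d - 1) ^ ((((l : ℝ) + d) / d) ^ d - 1)
    * (1 / ((l : ℝ) + d) ^ (3 * (l : ℝ) * (Real.exp 1 * ((l : ℝ) + d) / d) ^ d))

/-! ### Lagrange coefficients at equispaced nodes -/

section Lagrange

open Polynomial

/-! The scaled monomials have a bounded biorthogonal system on the cube: functions `g_s` with `∫ g_s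
U_r = δ_rs` and `|g_s| ≤ dualBound l ^ d`. Hence `c_s = ∫ g_s (c ⬝ᵥ U)`, and Cauchy–Schwarz bounds
`c_s²` by a constant times the quadratic form `∫ (c ⬝ᵥ U)²` (`sq_coeff_le`). Summing over at most
`(l + 1) ^ d` indices bounds the least eigenvalue below.

In one variable, integrating `x ^ m` over `(0, t]` samples `t ^ (m + 1) / (m + 1)`. Lagrange
interpolation recovers coefficients from such samples, so a combination of indicators is dual
(`integral_dualStep_mul`); products of these serve the cube.

The bound is crude, but `Λ` is far smaller still (`loewnerConst_mul_le_one`): the factor `e ^ d` in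
the exponent of its denominator absorbs every loss. -/

theorem abs_coeff_prod_C_mul_X_sub_C_le {ι : Type*} (s : Finset ι) (a b : ι → ℝ) (k : ℕ) :
    |(∏ i ∈ s, (C (a i) * (X - C (b i)))).coeff k| ≤ ∏ i ∈ s, (|a i| * (1 + |b i|)) := by
  classical
  induction s using Finset.induction_on generalizing k with
  | empty =>
    simp only [Finset.prod_empty, coeff_one]
    split_ifs <;> simp
  | insert i s hi ih =>
    rw [Finset.prod_insert hi, Finset.prod_insert hi, mul_assoc, coeff_C_mul, abs_mul, mul_assoc]
    gcongr
    rw [sub_mul, coeff_sub, coeff_C_mul, add_mul, one_mul]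
    rw [sub_eq_add_neg]
    refine (abs_add_le _ _).trans (add_le_add ?_ ?_)
    · cases k with
      | zero => simpa using Finset.prod_nonneg fun i _ => by positivity
      | succ k => simpa [coeff_X_mul] using ih k
    · rw [abs_neg, abs_mul]
      gcongr
      exact ih k

/-- Distinct nodes are at least `1 / (l + 1)` apart and lie in `[0, 1]`, so each of the `l + 1`
linear factors contributes at most `(l + 1) * 2`. -/
theorem abs_coeff_lagrangeBasis_le {l j : ℕ} (hj : j ∈ Finset.range (l + 2)) (k : ℕ) :
    |(Lagrange.basis (Finset.range (l + 2)) (fun i : ℕ => (i : ℝ) / (l + 1)) j).coeff k|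
      ≤ (2 * ((l : ℝ) + 1)) ^ (l + 1) := by
  unfold Lagrange.basis Lagrange.basisDivisor
  refine (abs_coeff_prod_C_mul_X_sub_C_le _ _ _ k).trans ?_
  refine (Finset.prod_le_prod (g := fun _ => 2 * ((l : ℝ) + 1))
    (fun _ _ => by positivity) ?_).trans (le_of_eq ?_)
  · intro i hi
    obtain ⟨hij, hi⟩ := Finset.mem_erase.1 hi
    have hl : (0 : ℝ) < l + 1 := by positivity
    have h1 : |((j : ℝ) / (l + 1) - i / (l + 1))⁻¹| ≤ l + 1 := by
      rw [← sub_div, inv_div, abs_div, abs_of_pos hl]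
      apply div_le_self hl.le
      have : (1 : ℤ) ≤ |(j : ℤ) - i| := Int.one_le_abs (by omega)
      exact_mod_cast this
    have h2 : |(i : ℝ) / (l + 1)| ≤ 1 := by
      rw [abs_of_nonneg (by positivity), div_le_one hl]
      have := Finset.mem_range.1 hi
      exact_mod_cast (by omega : i ≤ l + 1)
    calc _ ≤ ((l : ℝ) + 1) * (1 + 1) := by gcongr
      _ = _ := by ring
  · rw [Finset.prod_const, Finset.card_erase_of_mem hj]; simp

/-- Interpolation at `l + 2` nodes reproduces `X ^ (m + 1)`, of degree at most `l + 1`; compare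
coefficients of `X ^ (k + 1)`. The shift by one matches the exponent gained by integration. -/
theorem sum_lagrangeBasis_coeff_mul_pow {l m : ℕ} (hm : m ≤ l) (k : ℕ) :
    ∑ j ∈ Finset.range (l + 2),
      (Lagrange.basis (Finset.range (l + 2)) (fun i : ℕ => (i : ℝ) / (l + 1)) j).coeff (k + 1)
        * ((j : ℝ) / (l + 1)) ^ (m + 1) = if m = k then 1 else 0 := by
  have hinj : Set.InjOn (fun i : ℕ => (i : ℝ) / (l + 1)) (Finset.range (l + 2)) := by
    intro i _ j _ h
    have hl : (l : ℝ) + 1 ≠ 0 := by positivity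
    simpa [div_left_inj' hl] using h
  have h := Lagrange.eq_interpolate (f := (X : ℝ[X]) ^ (m + 1)) hinj (by
    rw [degree_X_pow, Finset.card_range]; exact_mod_cast (by omega : m + 1 < l + 2))
  have h' := congrArg (fun p => p.coeff (k + 1)) h
  simp only [Lagrange.interpolate_apply, finsetSum_coeff, coeff_C_mul, eval_pow, eval_X,
    coeff_X_pow, add_left_inj] at h'
  simp only [eq_comm (a := m), h']
  exact Finset.sum_congr rfl fun _ _ => mul_comm _ _

end Lagrange

/-! ### Dual functions in one variable -/

/-- A step function on `(0, 1]` dual to the scaled monomials `x ^ m / m!`, `m ≤ l`. -/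
noncomputable def dualStep (l k : ℕ) (x : ℝ) : ℝ :=
  ∑ j ∈ Finset.range (l + 2), (Nat.factorial (k + 1) : ℝ)
    * (Lagrange.basis (Finset.range (l + 2)) (fun i : ℕ => (i : ℝ) / (l + 1)) j).coeff (k + 1)
    * (Set.Ioc (0 : ℝ) ((j : ℝ) / (l + 1))).indicator 1 x

theorem measurable_dualStep (l k : ℕ) : Measurable (dualStep l k) := by
  unfold dualStep
  refine Finset.measurable_sum _ fun j _ => Measurable.const_mul ?_ _
  exact measurable_one.indicator measurableSet_Ioc

/-- A uniform bound for the functions `dualStep l k`, `k ≤ l`. -/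
noncomputable def dualBound (l : ℕ) : ℝ :=
  ((l : ℝ) + 2) * ((Nat.factorial (l + 1) : ℝ) * (2 * ((l : ℝ) + 1)) ^ (l + 1))

theorem abs_dualStep_le {l k : ℕ} (hk : k ≤ l) (x : ℝ) : |dualStep l k x| ≤ dualBound l := by
  refine (Finset.abs_sum_le_sum_abs _ _).trans
    ((Finset.sum_le_card_nsmul _ _
      ((Nat.factorial (l + 1) : ℝ) * (2 * ((l : ℝ) + 1)) ^ (l + 1)) ?_).trans (le_of_eq ?_))
  · intro j hj
    rw [abs_mul, abs_mul, Nat.abs_cast]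
    have h1 : |(Set.Ioc (0 : ℝ) ((j : ℝ) / (l + 1))).indicator (1 : ℝ → ℝ) x| ≤ 1 := by
      by_cases h : x ∈ Set.Ioc (0 : ℝ) ((j : ℝ) / (l + 1)) <;> simp [h]
    have h2 : (Nat.factorial (k + 1) : ℝ) ≤ Nat.factorial (l + 1) :=
      mod_cast Nat.factorial_le (by omega)
    calc _ ≤ (Nat.factorial (l + 1) : ℝ) * (2 * ((l : ℝ) + 1)) ^ (l + 1) * 1 :=
          mul_le_mul (mul_le_mul h2 (abs_coeff_lagrangeBasis_le hj _) (abs_nonneg _)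
            (by positivity)) h1 (abs_nonneg _) (by positivity)
      _ = _ := mul_one _
  · simp [dualBound]

theorem integral_dualStep_mul {l k m : ℕ} (hm : m ≤ l) :
    ∫ x in Set.Icc (-1 : ℝ) 1, dualStep l k x * (x ^ m / (Nat.factorial m : ℝ))
      = if m = k then 1 else 0 := by
  have key : ∀ j ∈ Finset.range (l + 2),
      ∫ x in Set.Icc (-1 : ℝ) 1, (Set.Ioc (0 : ℝ) ((j : ℝ) / (l + 1))).indicator
        (fun x => x ^ m) x = ((j : ℝ) / (l + 1)) ^ (m + 1) / (m + 1) := by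
    intro j hj
    have hj1 : (j : ℝ) / (l + 1) ≤ 1 := by
      rw [div_le_one (by positivity)]
      have := Finset.mem_range.1 hj
      exact_mod_cast (by omega : j ≤ l + 1)
    have hj0 : 0 ≤ (j : ℝ) / (l + 1) := by positivity
    rw [MeasureTheory.setIntegral_indicator measurableSet_Ioc, Set.inter_eq_self_of_subset_right,
      ← intervalIntegral.integral_of_le hj0, integral_pow]
    · simp
    · exact fun x hx => ⟨by linarith [hx.1], hx.2.trans hj1⟩
  have hint : ∀ j : ℕ, MeasureTheory.Integrable
      ((Set.Ioc (0 : ℝ) ((j : ℝ) / (l + 1))).indicator (fun x => x ^ m))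
      (MeasureTheory.volume.restrict (Set.Icc (-1 : ℝ) 1)) := by
    intro j
    refine MeasureTheory.Integrable.indicator ?_ measurableSet_Ioc
    exact (continuous_pow m).continuousOn.integrableOn_compact isCompact_Icc
  have hrw : ∀ x : ℝ, dualStep l k x * (x ^ m / (Nat.factorial m : ℝ)) =
      ∑ j ∈ Finset.range (l + 2), ((Nat.factorial (k + 1) : ℝ) / Nat.factorial m
        * (Lagrange.basis (Finset.range (l + 2)) (fun i : ℕ => (i : ℝ) / (l + 1)) j).coeff (k + 1))
        * (Set.Ioc (0 : ℝ) ((j : ℝ) / (l + 1))).indicator (fun x => x ^ m) x := by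
    intro x
    rw [dualStep, Finset.sum_mul]
    refine Finset.sum_congr rfl fun j _ => ?_
    by_cases h : x ∈ Set.Ioc (0 : ℝ) ((j : ℝ) / (l + 1))
    · simp only [Set.indicator_of_mem h, Pi.one_apply]; ring
    · simp only [Set.indicator_of_notMem h]; ring
  simp_rw [hrw]
  rw [MeasureTheory.integral_finsetSum _ fun j _ => (hint j).const_mul _]
  simp_rw [MeasureTheory.integral_const_mul]
  rw [Finset.sum_congr rfl fun j hj => by rw [key j hj]]
  -- The `m + 1` from integration turns `m!` into `(m + 1)!`, which cancels the normalisation `(k +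
  -- 1)!` when `m = k`.
  have hfac : (Nat.factorial (m + 1) : ℝ) = (m + 1) * Nat.factorial m := by
    push_cast [Nat.factorial_succ]; ring
  have h := congrArg (fun t => (Nat.factorial (k + 1) : ℝ) / Nat.factorial (m + 1) * t)
    (sum_lagrangeBasis_coeff_mul_pow hm k)
  simp only [Finset.mul_sum] at h
  have hm1 : (m : ℝ) + 1 ≠ 0 := by positivity
  have hmf : (Nat.factorial m : ℝ) ≠ 0 := by positivity
  rw [show (if m = k then (1 : ℝ) else 0)
      = (Nat.factorial (k + 1) : ℝ) / Nat.factorial (m + 1) * if m = k then 1 else 0 by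
    split_ifs with h
    · subst h; rw [div_self (by positivity), mul_one]
    · simp, ← h, hfac]
  refine Finset.sum_congr rfl fun j _ => ?_
  field_simp

/-! ### Size of the constants -/

theorem one_lt_ratio_pow {d l : ℕ} (hd : 19 ≤ d) (hl : d ≤ l) :
    1 < (((l : ℝ) + d) / d) ^ d := by
  have hd0 : (0 : ℝ) < d := by exact_mod_cast (by omega : 0 < d)
  have hl0 : (0 : ℝ) < l := by exact_mod_cast (by omega : 0 < l)
  refine one_lt_pow₀ ?_ (by omega)
  rw [one_lt_div hd0]; linarith

theorem loewnerConst_pos {d l : ℕ} (hd : 19 ≤ d) (hl : d ≤ l) : 0 < loewnerConst d l := by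
  have hq := sub_pos.2 (one_lt_ratio_pow hd hl)
  have hd0 : (0 : ℝ) < d := by exact_mod_cast (by omega : 0 < d)
  unfold loewnerConst
  have hpi := Real.pi_pos
  positivity

theorem dualBound_le {d l : ℕ} (hd : 19 ≤ d) (hl : d ≤ l) :
    dualBound l ≤ ((l : ℝ) + d) ^ (3 * l + 4) := by
  have hd' : (19 : ℝ) ≤ d := by exact_mod_cast hd
  have hl' : (d : ℝ) ≤ l := by exact_mod_cast hl
  have hf : (Nat.factorial (l + 1) : ℝ) ≤ ((l : ℝ) + d) ^ (l + 1) := by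
    have h : (Nat.factorial (l + 1) : ℝ) ≤ ((l + 1 : ℕ) : ℝ) ^ (l + 1) := by
      exact_mod_cast Nat.factorial_le_pow (l + 1)
    refine h.trans ?_
    push_cast
    gcongr
    linarith
  calc dualBound l ≤ ((l : ℝ) + d) * (((l : ℝ) + d) ^ (l + 1) * (((l : ℝ) + d) ^ 2) ^ (l + 1)) := by
        unfold dualBound
        gcongr
        · linarith
        · nlinarith
    _ = _ := by generalize (l : ℝ) + d = N; ring

/-- Everything is compared with powers of `N = l + d`: the two numerator factors of `Λ` are each at
most `N ^ (d q)`, and the duality constant is at most `N ^ (7 d l)`. -/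
theorem loewnerConst_mul_le_one {d l : ℕ} (hd : 19 ≤ d) (hl : d ≤ l) :
    loewnerConst d l * (((l : ℝ) + 1) ^ d * ((dualBound l ^ d) ^ 2 * 2 ^ d)) ≤ 1 := by
  have hd' : (19 : ℝ) ≤ d := by exact_mod_cast hd
  have hl' : (d : ℝ) ≤ l := by exact_mod_cast hl
  have hq1 := one_lt_ratio_pow hd hl
  have hb := dualBound_le hd hl
  have hb0 : 0 ≤ dualBound l := by unfold dualBound; positivity
  have hE : (Real.exp 1 * ((l : ℝ) + d) / d) ^ d = Real.exp d * (((l : ℝ) + d) / d) ^ d := by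
    rw [mul_div_assoc, mul_pow, ← Real.exp_nat_mul, mul_one]
  have hqN : (((l : ℝ) + d) / d) ^ d ≤ ((l : ℝ) + d) ^ d := by
    gcongr
    exact div_le_self (by linarith) (by linarith)
  unfold loewnerConst
  rw [hE]
  generalize (((l : ℝ) + d) / d) ^ d = q at *
  have hN1 : (1 : ℝ) ≤ (l : ℝ) + d := by linarith
  have hN0 : (0 : ℝ) < (l : ℝ) + d := by linarith
  set N : ℝ := (l : ℝ) + d with hN
  have h1 : (Real.pi * d / (8 * Real.exp 1 ^ 2)) ^ ((d : ℝ) * q) ≤ N ^ ((d : ℝ) * q) := by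
    have hpi := Real.pi_pos
    refine Real.rpow_le_rpow (by positivity) ?_ (by positivity)
    rw [div_le_iff₀ (by positivity)]
    have h4 := Real.pi_le_four
    have he : 1 ≤ Real.exp 1 ^ 2 := one_le_pow₀ (Real.one_le_exp (by norm_num))
    nlinarith
  have h2 : (q - 1) ^ (q - 1) ≤ N ^ ((d : ℝ) * q) := by
    calc (q - 1) ^ (q - 1) ≤ q ^ (q - 1) :=
          Real.rpow_le_rpow (by linarith) (by linarith) (by linarith)
      _ ≤ q ^ q := Real.rpow_le_rpow_of_exponent_le hq1.le (by linarith)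
      _ ≤ (N ^ d) ^ q := Real.rpow_le_rpow (by linarith) hqN (by linarith)
      _ = _ := by rw [Real.rpow_mul hN0.le, Real.rpow_natCast]
  have h3 : ((l : ℝ) + 1) ^ d * ((dualBound l ^ d) ^ 2 * 2 ^ d) ≤ N ^ (7 * (d : ℝ) * l) := by
    calc ((l : ℝ) + 1) ^ d * ((dualBound l ^ d) ^ 2 * 2 ^ d)
        ≤ N ^ d * (((N ^ (3 * l + 4)) ^ d) ^ 2 * N ^ d) := by
          gcongr <;> linarith
      _ = N ^ (d * (6 * l + 10)) := by clear_value N; ring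
      -- Uses `10 ≤ l`.
      _ ≤ N ^ (7 * d * l) := by
          refine pow_le_pow_right₀ hN1 ?_
          nlinarith
      _ = _ := by rw [← Real.rpow_natCast]; push_cast; rfl
  -- Since `l, q ≥ 1`, the left side is at most `9 d l q = 3 l * (3 d q)`, and `3 d ≤ e ^ d`.
  have hexp : 2 * (d : ℝ) * q + 7 * d * l ≤ 3 * l * (Real.exp d * q) := by
    have he := Real.quadratic_le_exp_of_nonneg (show (0 : ℝ) ≤ d by linarith)
    have he' : 3 * (d : ℝ) ≤ Real.exp d := by nlinarith
    have hq0 : (0 : ℝ) ≤ q := by linarith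
    have hlq : (0 : ℝ) ≤ l * q := by positivity
    have e1 : 3 * (l : ℝ) * (3 * d * q) ≤ 3 * l * (Real.exp d * q) := by gcongr
    have e2 : (d : ℝ) * q * 1 ≤ d * q * l := by gcongr; linarith
    have e3 : (d : ℝ) * l * 1 ≤ d * l * q := by gcongr
    nlinarith
  have hpos : 0 < N ^ (3 * (l : ℝ) * (Real.exp d * q)) := Real.rpow_pos_of_pos hN0 _
  rw [mul_one_div, div_mul_eq_mul_div, div_le_one hpos]
  have hpi := Real.pi_pos
  calc _ ≤ N ^ ((d : ℝ) * q) * N ^ ((d : ℝ) * q) * N ^ (7 * (d : ℝ) * l) := by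
        have := Real.rpow_nonneg (show (0 : ℝ) ≤ q - 1 by linarith) (q - 1)
        gcongr
    _ = N ^ (2 * (d : ℝ) * q + 7 * d * l) := by
        rw [← Real.rpow_add hN0, ← Real.rpow_add hN0]; congr 1; ring
    _ ≤ _ := Real.rpow_le_rpow_of_exponent_le hN1 hexp

/-! ### Cauchy–Schwarz and product duals on the cube -/

open MeasureTheory

/-- Integrating `(f - t g)² ≥ 0` with `g² ≤ K²` gives a quadratic in `t` that is nonnegative
everywhere, so its discriminant is nonpositive. -/
theorem sq_integral_mul_le_of_abs_le {α : Type*} [MeasurableSpace α] {μ : Measure α}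
    [IsFiniteMeasure μ] {f g : α → ℝ} {K : ℝ} (hg : AEStronglyMeasurable g μ)
    (hK : ∀ x, |g x| ≤ K) (hf : Integrable f μ) (hf2 : Integrable (fun x => f x ^ 2) μ) :
    (∫ x, g x * f x ∂μ) ^ 2 ≤ K ^ 2 * μ.real Set.univ * ∫ x, f x ^ 2 ∂μ := by
  have hgf : Integrable (fun x => g x * f x) μ :=
    hf.bdd_mul hg (Filter.Eventually.of_forall hK)
  set I := ∫ x, g x * f x ∂μ with hI
  set A := K ^ 2 * μ.real Set.univ with hA
  have hA0 : 0 ≤ A := by positivity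
  have hJ0 : 0 ≤ ∫ x, f x ^ 2 ∂μ := integral_nonneg fun x => sq_nonneg _
  have key : ∀ t : ℝ, 2 * t * I - t ^ 2 * A ≤ ∫ x, f x ^ 2 ∂μ := by
    intro t
    have h1 : ∫ x, (2 * t * (g x * f x) - t ^ 2 * K ^ 2) ∂μ = 2 * t * I - t ^ 2 * A := by
      rw [integral_sub (hgf.const_mul _) (integrable_const _), integral_const_mul, integral_const,
        smul_eq_mul]
      ring
    rw [← h1]
    refine integral_mono ((hgf.const_mul _).sub (integrable_const _)) hf2 fun x => ?_
    have h2 : g x ^ 2 ≤ K ^ 2 := sq_le_sq.2 ((hK x).trans (le_abs_self K))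
    have h3 : t ^ 2 * g x ^ 2 ≤ t ^ 2 * K ^ 2 := by gcongr
    change 2 * t * (g x * f x) - t ^ 2 * K ^ 2 ≤ f x ^ 2
    nlinarith [sq_nonneg (f x - t * g x)]
  have h := discrim_le_zero (a := A) (b := -2 * I) (c := ∫ x, f x ^ 2 ∂μ) fun t => by
    nlinarith [key t]
  unfold discrim at h
  nlinarith

/-- The product of one-dimensional dual step functions indexed by the entries of `s`. -/
noncomputable def dualCube (d l : ℕ) (s : MultiIndex d l) (u : Fin d → ℝ) : ℝ :=
  ∏ j, dualStep l (s.1 j) (u j)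

theorem measurable_dualCube (d l : ℕ) (s : MultiIndex d l) : Measurable (dualCube d l s) :=
  Finset.measurable_prod _ fun j _ => (measurable_dualStep _ _).comp (measurable_pi_apply j)

theorem abs_dualCube_le {d l : ℕ} (s : MultiIndex d l) (u : Fin d → ℝ) :
    |dualCube d l s u| ≤ dualBound l ^ d := by
  rw [dualCube, Finset.abs_prod]
  refine (Finset.prod_le_prod (fun _ _ => abs_nonneg _) fun j _ =>
    abs_dualStep_le (Nat.lt_succ_iff.1 (s.1 j).2) (u j)).trans (le_of_eq ?_)
  simp

theorem volume_restrict_cube (d : ℕ) :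
    (volume : Measure (Fin d → ℝ)).restrict (Set.Icc (fun _ => (-1 : ℝ)) (fun _ => (1 : ℝ)))
      = Measure.pi fun _ => (volume : Measure ℝ).restrict (Set.Icc (-1) 1) := by
  rw [← Set.pi_univ_Icc, volume_pi, Measure.restrict_pi_pi]

theorem integral_dualCube_mul {d l : ℕ} (r s : MultiIndex d l) :
    ∫ u in Set.Icc (fun _ : Fin d => (-1 : ℝ)) (fun _ => (1 : ℝ)),
      dualCube d l s u * scaledMonomials d l u r = if r = s then 1 else 0 := by
  simp only [dualCube, scaledMonomials, ← Finset.prod_div_distrib, ← Finset.prod_mul_distrib]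
  rw [volume_restrict_cube, integral_fintype_prod_eq_prod
    (f := fun j x => dualStep l (s.1 j) x * (x ^ (r.1 j : ℕ) / (Nat.factorial (r.1 j : ℕ) : ℝ)))]
  simp_rw [fun j => integral_dualStep_mul (k := (s.1 j : ℕ)) (Nat.lt_succ_iff.1 (r.1 j).2)]
  split_ifs with h
  · simp [h]
  · have : ∃ j, r.1 j ≠ s.1 j := by
      by_contra! hc
      exact h (Subtype.ext (funext hc))
    obtain ⟨j, hj⟩ := this
    exact Finset.prod_eq_zero (Finset.mem_univ j) (if_neg fun he => hj (Fin.ext he))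

/-! ### The quadratic form of the moment matrix -/

theorem continuous_scaledMonomials (d l : ℕ) (s : MultiIndex d l) :
    Continuous fun u => scaledMonomials d l u s := by
  unfold scaledMonomials
  fun_prop

theorem continuous_dotProduct_scaledMonomials (d l : ℕ) (c : MultiIndex d l → ℝ) :
    Continuous fun u => c ⬝ᵥ scaledMonomials d l u :=
  continuous_finsetSum _ fun s _ => continuous_const.mul (continuous_scaledMonomials d l s)

theorem dotProduct_momentMatrix_mulVec (d l : ℕ) (c : MultiIndex d l → ℝ) :
    c ⬝ᵥ (momentMatrix d l).mulVec c
      = ∫ u in Set.Icc (fun _ : Fin d => (-1 : ℝ)) (fun _ => (1 : ℝ)),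
          (c ⬝ᵥ scaledMonomials d l u) ^ 2 := by
  have hrw : ∀ u, (c ⬝ᵥ scaledMonomials d l u) ^ 2 = ∑ r, ∑ s, c r * c s
      * Matrix.vecMulVec (scaledMonomials d l u) (scaledMonomials d l u) r s := by
    intro u
    rw [sq, dotProduct, Finset.sum_mul_sum]
    refine Finset.sum_congr rfl fun r _ => Finset.sum_congr rfl fun s _ => ?_
    rw [Matrix.vecMulVec_apply]; ring
  have hint := integrableOn_momentMatrix_entry d l
  simp_rw [hrw]
  rw [integral_finsetSum _ fun r _ => integrable_finsetSum _ fun s _ => (hint r s).const_mul _]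
  refine Finset.sum_congr rfl fun r _ => ?_
  rw [integral_finsetSum _ fun s _ => (hint r s).const_mul _, Matrix.mulVec, dotProduct,
    Finset.mul_sum]
  refine Finset.sum_congr rfl fun s _ => ?_
  rw [integral_const_mul, momentMatrix]
  ring

theorem sq_coeff_le {d l : ℕ} (c : MultiIndex d l → ℝ) (s : MultiIndex d l) :
    c s ^ 2 ≤ (dualBound l ^ d) ^ 2 * 2 ^ d * (c ⬝ᵥ (momentMatrix d l).mulVec c) := by
  have hc := continuous_dotProduct_scaledMonomials d l c
  -- Biorthogonality extracts the single coefficient `c s`.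
  have hcoeff : ∫ u in Set.Icc (fun _ : Fin d => (-1 : ℝ)) (fun _ => (1 : ℝ)),
      dualCube d l s u * (c ⬝ᵥ scaledMonomials d l u) = c s := by
    simp only [dotProduct, Finset.mul_sum, mul_left_comm _ (c _)]
    rw [integral_finsetSum]
    · simp [integral_const_mul, integral_dualCube_mul]
    · intro r _
      refine Integrable.const_mul ?_ _
      exact ((continuous_scaledMonomials d l r).continuousOn.integrableOn_compact
        isCompact_Icc).bdd_mul (measurable_dualCube d l s).aestronglyMeasurable
        (Filter.Eventually.of_forall (abs_dualCube_le s))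
  have : IsFiniteMeasure ((volume : Measure (Fin d → ℝ)).restrict
      (Set.Icc (fun _ => (-1 : ℝ)) (fun _ => (1 : ℝ)))) :=
    isFiniteMeasure_restrict.2 (isCompact_Icc.measure_lt_top (μ := volume)).ne
  have hvol : ((volume : Measure (Fin d → ℝ)).restrict
      (Set.Icc (fun _ => (-1 : ℝ)) (fun _ => (1 : ℝ)))).real Set.univ = 2 ^ d := by
    rw [measureReal_def, Measure.restrict_apply_univ, Real.volume_Icc_pi_toReal fun _ => by norm_num]
    norm_num
  have h := sq_integral_mul_le_of_abs_le (μ := volume.restrict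
    (Set.Icc (fun _ : Fin d => (-1 : ℝ)) (fun _ => (1 : ℝ)))) (measurable_dualCube d l s).aestronglyMeasurable
    (abs_dualCube_le s) (hc.continuousOn.integrableOn_compact isCompact_Icc)
    ((hc.pow 2).continuousOn.integrableOn_compact isCompact_Icc)
  rwa [hcoeff, hvol, ← dotProduct_momentMatrix_mulVec] at h

theorem card_multiIndex_le (d l : ℕ) : (Fintype.card (MultiIndex d l) : ℝ) ≤ ((l : ℝ) + 1) ^ d := by
  have h := Fintype.card_subtype_le fun s : Fin d → Fin (l + 1) => ∑ j, (s j : ℕ) ≤ l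
  rw [Fintype.card_fun, Fintype.card_fin, Fintype.card_fin] at h
  exact_mod_cast h

theorem momentMatrix_isSymm (d l : ℕ) : (momentMatrix d l).IsSymm := by
  ext r s
  simp only [Matrix.transpose_apply, momentMatrix, Matrix.vecMulVec_apply, mul_comm]

theorem mainTheorem3 (d l : ℕ) (hd : 19 ≤ d) (hl : d ≤ l) :
    0 < loewnerConst d l ∧
      (momentMatrix d l).IsSymm ∧
      (momentMatrix d l
        - loewnerConst d l • (1 : Matrix (MultiIndex d l) (MultiIndex d l) ℝ)).PosSemidef := by
  have hpos := loewnerConst_pos hd hl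
  refine ⟨hpos, momentMatrix_isSymm d l, .of_dotProduct_mulVec_nonneg ?_ fun c => ?_⟩
  · rw [Matrix.IsHermitian, Matrix.conjTranspose_eq_transpose_of_trivial, Matrix.transpose_sub,
      Matrix.transpose_smul, Matrix.transpose_one, momentMatrix_isSymm d l]
  · rw [star_trivial, Matrix.sub_mulVec, Matrix.smul_mulVec, Matrix.one_mulVec, dotProduct_sub,
      dotProduct_smul, smul_eq_mul, sub_nonneg]
    have hJ : 0 ≤ c ⬝ᵥ (momentMatrix d l).mulVec c := by
      rw [dotProduct_momentMatrix_mulVec]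
      exact integral_nonneg fun u => sq_nonneg _
    have hsum : c ⬝ᵥ c ≤ ((l : ℝ) + 1) ^ d * ((dualBound l ^ d) ^ 2 * 2 ^ d)
        * (c ⬝ᵥ (momentMatrix d l).mulVec c) := by
      calc c ⬝ᵥ c = ∑ s, c s ^ 2 := by simp only [dotProduct, sq]
        _ ≤ ∑ _s : MultiIndex d l,
            (dualBound l ^ d) ^ 2 * 2 ^ d * (c ⬝ᵥ (momentMatrix d l).mulVec c) :=
          Finset.sum_le_sum fun s _ => sq_coeff_le c s
        _ = Fintype.card (MultiIndex d l)
            * ((dualBound l ^ d) ^ 2 * 2 ^ d * (c ⬝ᵥ (momentMatrix d l).mulVec c)) := by simp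
        _ ≤ ((l : ℝ) + 1) ^ d
            * ((dualBound l ^ d) ^ 2 * 2 ^ d * (c ⬝ᵥ (momentMatrix d l).mulVec c)) := by
          gcongr
          exact card_multiIndex_le d l
        _ = _ := by ring
    calc loewnerConst d l * (c ⬝ᵥ c)
        ≤ loewnerConst d l * (((l : ℝ) + 1) ^ d * ((dualBound l ^ d) ^ 2 * 2 ^ d))
            * (c ⬝ᵥ (momentMatrix d l).mulVec c) := by
          rw [mul_assoc]
          gcongr
      _ ≤ 1 * (c ⬝ᵥ (momentMatrix d l).mulVec c) := by
          gcongr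
          exact loewnerConst_mul_le_one hd hl
      _ = _ := one_mul _
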